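/- Let $G$ be a compact, second countable Hausdorff topological group with Haar measure $dt$, let $\widehat G$ be its unitary dual (a set of representatives $(\pi,H_\pi)$, one from each unitary equivalence class of irreducible, strongly continuous unitary representations of $G$ on Hilbert spaces), and let $d_\pi=\dim H_\pi<\infty$. For each $\pi\in\widehat G$ let $E_\pi\subseteq H_\pi$ be a (possibly trivial) subspace, put $s_\pi=\dim E_\pi$, and let $e_1,\dots,e_{d_\pi}$ be an orthonormal basis of $H_\pi$ such that $e_1,\dots,e_{s_\pi}$ is a basis of $E_\pi$ (no condition if $E_\pi=\{0\}$). Let $\pi_{ij}(t)=(\pi(t)e_j,e_i)$, $1\le i,j\le d_\pi$, where $(\cdot,\cdot)$ is linear in the first variable, be the corresponding matrix coefficients, and let $$J(E)=\overline{\operatorname{span}\{\pi_{ij}:\ \pi\in\widehat G,\ E_\pi\neq\{0\},\ 1\le i\le d_\pi,\ 1\le j\le s_\pi\}}^{\|\cdot\|_1}\subseteq L^1(G).$$ Then the annihilator $J(E)^\perp=\{h\in L^\infty(G): \int_G h(t)f(t)\,dt=0 \text{ for all } f\in J(E)\}$ is the closure, in the weak* topology $\sigma(L^\infty(G),L^1(G))$,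 of the linear span of $$\{\overline{\pi_{ij}}:\ E_\pi\neq\{0\},\ 1\le i\le d_\pi,\ s_\pi<j\le d_\pi\}\ \cup\ \{\overline{\pi_{ij}}:\ E_\pi=\{0\},\ 1\le i,j\le d_\pi\}.$$ -/

import Mathlib

open MeasureTheory
open scoped ENNReal

/-- A (strongly continuous) unitary representation of a topological group `G` on an inner product
space `H`. Completeness of `H` is imposed where it is needed. -/
structure UnitaryRep (G : Type*) [Group G] [TopologicalSpace G]
    (H : Type*) [NormedAddCommGroup H] [InnerProductSpace ℂ H] where
  /-- The underlying homomorphism into the unitary operators of `H`. -/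
  toHom : G →* (H ≃ₗᵢ[ℂ] H)
  /-- Strong continuity. -/
  continuous_apply : ∀ x : H, Continuous fun g : G => toHom g x

namespace UnitaryRep

section Reps

variable {G : Type*} [Group G] [TopologicalSpace G]
variable {H : Type*} [NormedAddCommGroup H] [InnerProductSpace ℂ H]
variable {K : Type*} [NormedAddCommGroup K] [InnerProductSpace ℂ K]

/-- Irreducibility: `H` is nonzero and `{0}`, `H` are the only closed invariant subspaces. -/
def IsIrreducible (π : UnitaryRep G H) : Prop :=
  Nontrivial H ∧ ∀ W : Submodule ℂ H, IsClosed (W : Set H) →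
    (∀ g : G, ∀ x ∈ W, π.toHom g x ∈ W) → W = ⊥ ∨ W = ⊤

/-- Unitary equivalence of representations. -/
def Equivalent (π : UnitaryRep G H) (σ : UnitaryRep G K) : Prop :=
  ∃ U : H ≃ₗᵢ[ℂ] K, ∀ (g : G) (x : H), U (π.toHom g x) = σ.toHom g (U x)

/-- The matrix coefficient `g ↦ (π(g) x, y)`, where `(·,·)` is linear in the first variable
(Mathlib's `inner` is linear in the second one). -/
noncomputable def matrixCoeff (π : UnitaryRep G H) (x y : H) : C(G, ℂ) where
  toFun g := inner ℂ y (π.toHom g x)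
  continuous_toFun := continuous_const.inner (π.continuous_apply x)

end Reps

universe u v w

/-- The family `π` is a full set of representatives of the unitary dual of `G`: every member is
an irreducible unitary representation, and every irreducible unitary representation of `G` on a
Hilbert space is equivalent to exactly one member. -/
structure IsUnitaryDual {G : Type u} [Group G] [TopologicalSpace G] {ι : Type w} {H : ι → Type v}
    [∀ i, NormedAddCommGroup (H i)] [∀ i, InnerProductSpace ℂ (H i)]
    (π : ∀ i, UnitaryRep G (H i)) : Prop where
  irreducible : ∀ i, (π i).IsIrreducible
  eq_of_equivalent : ∀ i j, (π i).Equivalent (π j) → i = j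
  exhaustive : ∀ (V : Type v) [NormedAddCommGroup V] [InnerProductSpace ℂ V] [CompleteSpace V]
    (σ : UnitaryRep G V), σ.IsIrreducible → ∃ i, σ.Equivalent (π i)

end UnitaryRep

noncomputable section

section Duality

variable {G : Type*} [MeasurableSpace G] (μ : Measure G)

/-- The bilinear duality `⟨h, f⟩ = ∫ h f dμ` between `L^∞` and `L^1`. -/
def linftyPairing : Lp ℂ ∞ μ →ₗ[ℂ] Lp ℂ 1 μ →ₗ[ℂ] ℂ :=
  LinearMap.mk₂ ℂ (fun h f => (ContinuousLinearMap.mul ℂ ℂ).lpPairing μ ∞ 1 h f)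
    (by intros; simp) (by intros; simp) (by intros; simp) (by intros; simp)

theorem linftyPairing_apply (h : Lp ℂ ∞ μ) (f : Lp ℂ 1 μ) :
    linftyPairing μ h f = ∫ x, h x * f x ∂μ := by
  simp [linftyPairing, ContinuousLinearMap.lpPairing_eq_integral]

/-- The weak* topology `σ(L^∞, L^1)` on `L^∞`. -/
abbrev weakStarTopology : TopologicalSpace (Lp ℂ ∞ μ) :=
  WeakBilin.instTopologicalSpace (linftyPairing μ)

/-- The annihilator in `L^∞` of a subspace of `L^1`. -/
def linftyAnnihilator (J : Submodule ℂ (Lp ℂ 1 μ)) : Submodule ℂ (Lp ℂ ∞ μ) where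
  carrier := {h | ∀ f ∈ J, linftyPairing μ h f = 0}
  add_mem' := by
    intro a b ha hb f hf
    simp [ha f hf, hb f hf]
  zero_mem' := by
    intro f _
    simp
  smul_mem' := by
    intro c a ha f hf
    simp [ha f hf]

end Duality

section Ideal

variable {G : Type*} [Group G] [TopologicalSpace G] [CompactSpace G] [MeasurableSpace G]
  [BorelSpace G] (μ : Measure G) [IsFiniteMeasure μ]
variable {ι : Type*} {H : ι → Type*} [∀ i, NormedAddCommGroup (H i)]
  [∀ i, InnerProductSpace ℂ (H i)] (π : ∀ i, UnitaryRep G (H i))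
  (E : ∀ i, Submodule ℂ (H i)) {d : ι → ℕ} (e : ∀ i, OrthonormalBasis (Fin (d i)) ℂ (H i))

/-- `J(E)`: the `L^1`-closed linear span of the coefficients `π_kl = (π(·) e_l, e_k)`, over all
`π` with `E_π ≠ 0`, all `k`, and the first `s_π = dim E_π` indices `l`. -/
def idealOf : Submodule ℂ (Lp ℂ 1 μ) :=
  (Submodule.span ℂ {f : Lp ℂ 1 μ | ∃ (i : ι) (k l : Fin (d i)),
    E i ≠ ⊥ ∧ (l : ℕ) < Module.finrank ℂ (E i) ∧
      f = ContinuousMap.toLp 1 μ ℂ ((π i).matrixCoeff (e i l) (e i k))}).topologicalClosure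

/-- The conjugates, in `L^∞`, of the remaining matrix coefficients. -/
def conjRemainingCoeffs : Set (Lp ℂ ∞ μ) :=
  {h | ∃ (i : ι) (k l : Fin (d i)), E i ≠ ⊥ ∧ Module.finrank ℂ (E i) ≤ (l : ℕ) ∧
      h = ContinuousMap.toLp ∞ μ ℂ (star ((π i).matrixCoeff (e i l) (e i k)))} ∪
  {h | ∃ (i : ι) (k l : Fin (d i)), E i = ⊥ ∧
      h = ContinuousMap.toLp ∞ μ ℂ (star ((π i).matrixCoeff (e i l) (e i k)))}

end Ideal

end

/-!
The weak* closure of a subspace is its double annihilator, so the claim is that `h ∈ J(E)^⊥` pairs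
to zero with every `f ∈ L¹` annihilated by the conjugates of the remaining coefficients, together
with the inclusion of these conjugates in the weak*-closed space `J(E)^⊥`.

The inclusion is Schur orthogonality
(`UnitaryRep.integral_matrixCoeff_mul_star_of_not_equivalent` and
`UnitaryRep.integral_matrixCoeff_mul_star_of_inner_eq_zero`).

For the vanishing of `⟨h, f⟩`, consider the function `F(s) = ⟨h, L_s f⟩ = ∫ h(t) f(s⁻¹ t) dt`. It is
continuous, since translation is strongly continuous on `L¹`, and `F(1) = ⟨h, f⟩`. By Fubini and the
multiplicativity of `π`,
`∫ F π_kl = ∑ₘ (∫ h π_km) (∫ f conj(π_lm))`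
(`UnitaryRep.integral_matrixCoeff_mul_integral_translate`). In every summand one factor vanishes:
the first if `E_π ≠ 0` and `π_km` is among the generators of `J(E)`, the second otherwise. Hence `F`
is orthogonal to the conjugates of all matrix coefficients, and `F = 0` by the completeness half of
the Peter–Weyl theorem.

That half, `UnitaryRep.IsUnitaryDual.eq_zero_of_integral_mul_matrixCoeff`, is obtained from
the following fact about an arbitrary unitary representation of a compact group and a vector
`w ≠ 0` (`UnitaryRep.exists_irreducible_matrixCoeff_ne_zero`): the coefficient map
`A x = ⟪w, π(·) x⟫` into `L²` is compact by the Arzelà–Ascoli theorem and intertwines `π` with right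
translation, so `A* A` has a finite-dimensional invariant eigenspace on which `A` is injective. It
is applied to the left regular representation on `L²` with `w = F`, where the same product formula
shows that the resulting coefficients are orthogonal to themselves.
-/

/-! ### Haar measure on a compact group -/

namespace MeasureTheory.Measure

variable {G : Type*} [Group G] [TopologicalSpace G] [IsTopologicalGroup G] [CompactSpace G]
  [MeasurableSpace G] [BorelSpace G]

/-- On a compact group, a left-invariant finite measure of the same total mass as a Haar measure
equals it. -/
theorem eq_of_isMulLeftInvariant_of_univ_eq (ν μ : Measure G) [μ.IsHaarMeasure]
    [ν.IsMulLeftInvariant] [IsFiniteMeasure ν] (h : ν Set.univ = μ Set.univ) : ν = μ := by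
  have hν := isMulInvariant_eq_smul_of_compactSpace ν μ
  have h1 : haarScalarFactor ν μ = 1 := by
    have h2 := congrArg (fun m : Measure G => m Set.univ) hν
    simp only [smul_apply, ENNReal.smul_def, smul_eq_mul] at h2
    rw [h] at h2
    have h3 : μ Set.univ ≠ 0 := (isOpen_univ.measure_pos μ Set.univ_nonempty).ne'
    have h4 : μ Set.univ ≠ ⊤ := measure_ne_top μ _
    exact_mod_cast (ENNReal.mul_eq_right h3 h4).1 h2.symm
  rw [hν, h1, one_smul]

/-- A Haar measure on a compact group is right-invariant: right translates are left-invariant and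
have the same total mass. -/
theorem isMulRightInvariant_of_compactSpace (μ : Measure G) [μ.IsHaarMeasure] :
    μ.IsMulRightInvariant where
  map_mul_right_eq_self g := by
    have := Measure.isFiniteMeasure_map μ (· * g)
    refine eq_of_isMulLeftInvariant_of_univ_eq _ μ ?_
    rw [map_apply (measurable_mul_const g) MeasurableSet.univ, Set.preimage_univ]

/-- A Haar measure on a compact group is invariant under inversion. -/
theorem isInvInvariant_of_compactSpace (μ : Measure G) [μ.IsHaarMeasure] :
    μ.IsInvInvariant where
  inv_eq_self := by
    have := isMulRightInvariant_of_compactSpace μ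
    have : IsFiniteMeasure μ.inv := Measure.isFiniteMeasure_map μ Inv.inv
    refine eq_of_isMulLeftInvariant_of_univ_eq _ μ ?_
    simp

end MeasureTheory.Measure

/-! ### Unitary representations and Schur's lemma -/

namespace UnitaryRep

section Basic

variable {G : Type*} [Group G] [TopologicalSpace G]
variable {H : Type*} [NormedAddCommGroup H] [InnerProductSpace ℂ H]
variable {K : Type*} [NormedAddCommGroup K] [InnerProductSpace ℂ K]

theorem toHom_mul_apply (π : UnitaryRep G H) (g h : G) (x : H) :
    π.toHom (g * h) x = π.toHom g (π.toHom h x) := by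
  rw [map_mul]; rfl

theorem toHom_one_apply (π : UnitaryRep G H) (x : H) : π.toHom 1 x = x := by
  rw [map_one]; rfl

theorem toHom_inv_toHom (π : UnitaryRep G H) (g : G) (x : H) :
    π.toHom g⁻¹ (π.toHom g x) = x := by
  rw [← toHom_mul_apply, inv_mul_cancel, toHom_one_apply]

theorem inner_toHom_inv (π : UnitaryRep G H) (g : G) (x y : H) :
    inner ℂ (π.toHom g⁻¹ x) y = inner ℂ x (π.toHom g y) := by
  rw [← (π.toHom g⁻¹).inner_map_map x (π.toHom g y), toHom_inv_toHom]

theorem matrixCoeff_apply (π : UnitaryRep G H) (x y : H) (g : G) :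
    π.matrixCoeff x y g = inner ℂ y (π.toHom g x) := rfl

/-- The coefficient at `t r⁻¹` separates the variables along an orthonormal basis. -/
theorem matrixCoeff_mul_inv {n : Type*} [Fintype n] (π : UnitaryRep G H)
    (b : OrthonormalBasis n ℂ H) (x y : H) (t r : G) :
    π.matrixCoeff x y (t * r⁻¹) =
      ∑ m, π.matrixCoeff (b m) y t * star (π.matrixCoeff (b m) x r) := by
  simp only [matrixCoeff_apply, toHom_mul_apply]
  rw [← inner_toHom_inv, ← b.sum_inner_mul_inner]
  refine Finset.sum_congr rfl fun m _ => ?_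
  rw [inner_toHom_inv, ← inner_toHom_inv π r, RCLike.star_def, inner_conj_symm]

/-- The representation on an invariant subspace. -/
def restrict (π : UnitaryRep G H) (W : Submodule ℂ H)
    (hW : ∀ g : G, ∀ x ∈ W, π.toHom g x ∈ W) : UnitaryRep G W where
  toHom :=
    { toFun := fun g =>
        { toFun := fun x => ⟨π.toHom g x, hW g x x.2⟩
          invFun := fun x => ⟨π.toHom g⁻¹ x, hW g⁻¹ x x.2⟩
          map_add' := fun x y => by ext; simp
          map_smul' := fun c x => by ext; simp
          left_inv := fun x => by ext; simp
          right_inv := fun x => by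
            ext; simpa only [inv_inv] using π.toHom_inv_toHom g⁻¹ (x : H)
          norm_map' := fun x => (π.toHom g).norm_map x }
      map_one' := by ext x; exact π.toHom_one_apply x
      map_mul' := fun g h => by ext x; exact π.toHom_mul_apply g h x }
  continuous_apply x := (π.continuous_apply x).subtype_mk _

/-- Transport of a representation along a unitary isomorphism. -/
def transport (π : UnitaryRep G H) (U : H ≃ₗᵢ[ℂ] K) : UnitaryRep G K where
  toHom :=
    { toFun := fun g => (U.symm.trans (π.toHom g)).trans U
      map_one' := by ext x; simp
      map_mul' := fun g h => by ext x; simp }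
  continuous_apply x := U.continuous.comp (π.continuous_apply _)

theorem transport_apply (π : UnitaryRep G H) (U : H ≃ₗᵢ[ℂ] K) (g : G) (x : K) :
    (π.transport U).toHom g x = U (π.toHom g (U.symm x)) := rfl

theorem equivalent_transport (π : UnitaryRep G H) (U : H ≃ₗᵢ[ℂ] K) :
    π.Equivalent (π.transport U) :=
  ⟨U, fun g x => by simp [transport_apply]⟩

theorem Equivalent.trans {L : Type*} [NormedAddCommGroup L] [InnerProductSpace ℂ L]
    {π : UnitaryRep G H} {σ : UnitaryRep G K} {τ : UnitaryRep G L}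
    (h₁ : π.Equivalent σ) (h₂ : σ.Equivalent τ) : π.Equivalent τ := by
  obtain ⟨U, hU⟩ := h₁
  obtain ⟨V, hV⟩ := h₂
  exact ⟨U.trans V, fun g x => by simp [hU, hV]⟩

theorem IsIrreducible.transport {π : UnitaryRep G H} (h : π.IsIrreducible) (U : H ≃ₗᵢ[ℂ] K) :
    (π.transport U).IsIrreducible := by
  obtain ⟨hH, hirr⟩ := h
  refine ⟨U.symm.toEquiv.nontrivial, fun W hWc hW => ?_⟩
  rcases hirr (W.comap (U.toLinearEquiv : H →ₗ[ℂ] K)) (hWc.preimage U.continuous)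
    (fun g x hx => by simpa [transport_apply] using hW g (U x) hx) with h | h
  · left
    rw [eq_bot_iff]
    intro y hy
    have : U.symm y ∈ W.comap (U.toLinearEquiv : H →ₗ[ℂ] K) := by simpa using hy
    rw [h] at this
    simpa using this
  · right
    rw [eq_top_iff]
    intro y _
    have : U.symm y ∈ W.comap (U.toLinearEquiv : H →ₗ[ℂ] K) := by rw [h]; trivial
    simpa using this

theorem Equivalent.matrixCoeff_eq {π : UnitaryRep G H} {σ : UnitaryRep G K}
    {U : H ≃ₗᵢ[ℂ] K} (hU : ∀ (g : G) (x : H), U (π.toHom g x) = σ.toHom g (U x)) (x y : H) :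
    π.matrixCoeff x y = σ.matrixCoeff (U x) (U y) := by
  ext g
  simp only [matrixCoeff_apply, ← hU, LinearIsometryEquiv.inner_map_map]

theorem matrixCoeff_eq_sum {n : Type*} [Fintype n] (π : UnitaryRep G H)
    (b : OrthonormalBasis n ℂ H) (x y : H) :
    π.matrixCoeff x y = ∑ l, ∑ k, (b.repr x l * star (b.repr y k)) •
      π.matrixCoeff (b l) (b k) := by
  ext g
  simp only [ContinuousMap.sum_apply, ContinuousMap.smul_apply, matrixCoeff_apply, smul_eq_mul]
  conv_lhs => rw [← b.sum_repr y, ← b.sum_repr x]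
  simp only [map_sum, sum_inner, inner_sum, inner_smul_left, inner_smul_right, map_smul,
    Finset.mul_sum, RCLike.star_def, mul_assoc]

end Basic

section Schur

variable {G : Type*} [Group G] [TopologicalSpace G]
variable {H : Type*} [NormedAddCommGroup H] [InnerProductSpace ℂ H] [FiniteDimensional ℂ H]
variable {K : Type*} [NormedAddCommGroup K] [InnerProductSpace ℂ K] [FiniteDimensional ℂ K]

/-- **Schur's lemma**: an endomorphism of a finite-dimensional irreducible representation is a
scalar. -/
theorem IsIrreducible.exists_eq_smul {π : UnitaryRep G H} (hπ : π.IsIrreducible)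
    (T : H →ₗ[ℂ] H) (hT : ∀ g x, T (π.toHom g x) = π.toHom g (T x)) :
    ∃ c : ℂ, ∀ x, T x = c • x := by
  have := hπ.1
  obtain ⟨c, hc⟩ := Module.End.exists_eigenvalue T
  refine ⟨c, fun x => ?_⟩
  have htop : Module.End.eigenspace T c = ⊤ := by
    refine (hπ.2 _ (Submodule.closed_of_finiteDimensional _) fun g x hx => ?_).resolve_left hc
    rw [Module.End.mem_eigenspace_iff] at hx ⊢
    rw [hT, hx, map_smul]
  exact Module.End.mem_eigenspace_iff.1 (htop ▸ Submodule.mem_top)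

/-- **Schur's lemma**: a nonzero intertwiner between finite-dimensional irreducible representations
is a multiple of a unitary equivalence, because `B* B` is a positive scalar. -/
theorem IsIrreducible.equivalent_of_intertwiner_ne_zero {π : UnitaryRep G H}
    {σ : UnitaryRep G K} (hπ : π.IsIrreducible) (hσ : σ.IsIrreducible) (B : H →ₗ[ℂ] K)
    (hB : ∀ g x, B (π.toHom g x) = σ.toHom g (B x)) (hB0 : B ≠ 0) : π.Equivalent σ := by
  obtain ⟨c, hc⟩ := hπ.exists_eq_smul (B.adjoint ∘ₗ B) fun g x => by
    refine ext_inner_left ℂ fun y => ?_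
    rw [← inner_toHom_inv]
    simp only [LinearMap.comp_apply, LinearMap.adjoint_inner_right, hB, inner_toHom_inv]
  have hnorm : ∀ x, (‖B x‖ : ℂ) ^ 2 = c * (‖x‖ : ℂ) ^ 2 := fun x => by
    have h1 := LinearMap.adjoint_inner_right B x (B x)
    rw [← LinearMap.comp_apply, hc, inner_smul_right, inner_self_eq_norm_sq_to_K,
      inner_self_eq_norm_sq_to_K] at h1
    exact h1.symm
  obtain ⟨v, hv⟩ : ∃ v, B v ≠ 0 := by
    by_contra! h
    exact hB0 (LinearMap.ext h)
  have hv0 : ‖v‖ ≠ 0 := fun h => hv (by rw [norm_eq_zero.1 h, map_zero])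
  -- `r` is the positive square root of the scalar `c`.
  set r : ℝ := ‖B v‖ / ‖v‖ with hr
  have hr0 : r ≠ 0 := div_ne_zero (norm_ne_zero_iff.2 hv) hv0
  have hrpos : 0 ≤ r := by positivity
  have hcr : c = (r : ℂ) ^ 2 := by
    have := hnorm v
    have hv0' : (‖v‖ : ℂ) ≠ 0 := by exact_mod_cast hv0
    rw [hr]; push_cast; field_simp; exact this.symm
  have hBn : ∀ x, ‖B x‖ = r * ‖x‖ := fun x => by
    have := hnorm x
    rw [hcr] at this
    norm_cast at this
    rw [← mul_pow] at this
    exact (pow_left_inj₀ (norm_nonneg _) (by positivity) two_ne_zero).1 this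
  have hr0' : (r : ℂ) ≠ 0 := by exact_mod_cast hr0
  let V : H →ₗᵢ[ℂ] K :=
    { toLinearMap := (r : ℂ)⁻¹ • B
      norm_map' := fun x => by
        rw [LinearMap.smul_apply, norm_smul, hBn, norm_inv, Complex.norm_real,
          Real.norm_of_nonneg hrpos, inv_mul_cancel_left₀ hr0] }
  have hVB : ∀ x, V x = (r : ℂ)⁻¹ • B x := fun x => rfl
  have hVi : ∀ g x, V (π.toHom g x) = σ.toHom g (V x) := fun g x => by
    rw [hVB, hVB, hB, map_smul]
  have hrange : LinearMap.range V.toLinearMap = ⊤ := by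
    refine (hσ.2 _ (Submodule.closed_of_finiteDimensional _) ?_).resolve_left fun h => ?_
    · rintro g _ ⟨x, rfl⟩
      exact ⟨π.toHom g x, hVi g x⟩
    · have h1 : V.toLinearMap = 0 := LinearMap.range_eq_bot.1 h
      have h2 : V v = 0 := LinearMap.congr_fun h1 v
      exact hv ((smul_eq_zero.1 ((hVB v).symm.trans h2)).resolve_left (inv_ne_zero hr0'))
  exact ⟨LinearIsometryEquiv.ofSurjective V (LinearMap.range_eq_top.1 hrange), hVi⟩

end Schur

end UnitaryRep

/-! ### Schur orthogonality -/

namespace UnitaryRep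

variable {G : Type*} [Group G] [TopologicalSpace G] [IsTopologicalGroup G] [CompactSpace G]
  [MeasurableSpace G] [BorelSpace G] (μ : Measure G) [μ.IsHaarMeasure]
variable {H : Type*} [NormedAddCommGroup H] [InnerProductSpace ℂ H]
variable {K : Type*} [NormedAddCommGroup K] [InnerProductSpace ℂ K]

/-- The Haar average of the rank-one maps `u ↦ ⟪x, π(t) u⟫ σ(t)⁻¹ y`, an intertwiner from `π`
to `σ`. -/
noncomputable def averagedRankOne (π : UnitaryRep G H) (σ : UnitaryRep G K) (x : H) (y : K) :
    H →ₗ[ℂ] K where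
  toFun u := ∫ t, π.matrixCoeff u x t • σ.toHom t⁻¹ y ∂μ
  map_add' u v := by
    rw [← integral_add]
    · simp only [matrixCoeff_apply, map_add, inner_add_right, add_smul]
    all_goals
      exact Continuous.integrable_of_hasCompactSupport ((ContinuousMap.continuous _).smul
        ((σ.continuous_apply y).comp continuous_inv)) (HasCompactSupport.of_compactSpace _)
  map_smul' c u := by
    rw [RingHom.id_apply, ← integral_smul]
    simp only [matrixCoeff_apply, map_smul, inner_smul_right, smul_smul]

theorem averagedRankOne_apply (π : UnitaryRep G H) (σ : UnitaryRep G K) (x u : H) (y : K) :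
    averagedRankOne μ π σ x y u = ∫ t, π.matrixCoeff u x t • σ.toHom t⁻¹ y ∂μ := rfl

theorem averagedRankOne_toHom (π : UnitaryRep G H) (σ : UnitaryRep G K) (x : H) (y : K)
    (g : G) (u : H) :
    averagedRankOne μ π σ x y (π.toHom g u) = σ.toHom g (averagedRankOne μ π σ x y u) := by
  have := Measure.isMulRightInvariant_of_compactSpace μ
  simp only [averagedRankOne_apply]
  have h1 : σ.toHom g (∫ t, π.matrixCoeff u x t • σ.toHom t⁻¹ y ∂μ) =
      ∫ t, σ.toHom g (π.matrixCoeff u x t • σ.toHom t⁻¹ y) ∂μ :=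
    ((σ.toHom g).toContinuousLinearEquiv.integral_comp_comm _).symm
  rw [h1, ← integral_mul_right_eq_self
    (fun t => σ.toHom g (π.matrixCoeff u x t • σ.toHom t⁻¹ y)) g]
  refine integral_congr_ae (Filter.Eventually.of_forall fun t => ?_)
  simp only [map_smul, matrixCoeff_apply, ← toHom_mul_apply, mul_inv_rev, mul_inv_cancel_left]

theorem inner_averagedRankOne [CompleteSpace K] (π : UnitaryRep G H) (σ : UnitaryRep G K)
    (x u : H) (y v : K) :
    inner ℂ v (averagedRankOne μ π σ x y u) =
      ∫ t, π.matrixCoeff u x t * star (σ.matrixCoeff v y t) ∂μ := by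
  rw [averagedRankOne_apply, ← integral_inner]
  · refine integral_congr_ae (Filter.Eventually.of_forall fun t => ?_)
    simp only [matrixCoeff_apply, inner_smul_right, RCLike.star_def, inner_conj_symm]
    rw [← inner_toHom_inv σ t⁻¹, inv_inv]
  · exact Continuous.integrable_of_hasCompactSupport ((ContinuousMap.continuous _).smul
      ((σ.continuous_apply y).comp continuous_inv)) (HasCompactSupport.of_compactSpace _)

variable [FiniteDimensional ℂ H] [FiniteDimensional ℂ K]

/-- Coefficients of inequivalent finite-dimensional irreducible representations are orthogonal. -/
theorem integral_matrixCoeff_mul_star_of_not_equivalent {π : UnitaryRep G H}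
    {σ : UnitaryRep G K} (hπ : π.IsIrreducible) (hσ : σ.IsIrreducible)
    (h : ¬ π.Equivalent σ) (x u : H) (y v : K) :
    ∫ t, π.matrixCoeff u x t * star (σ.matrixCoeff v y t) ∂μ = 0 := by
  have := FiniteDimensional.complete ℂ K
  rw [← inner_averagedRankOne]
  by_cases hB : averagedRankOne μ π σ x y = 0
  · rw [hB, LinearMap.zero_apply, inner_zero_right]
  · exact absurd (hπ.equivalent_of_intertwiner_ne_zero hσ _ (averagedRankOne_toHom μ π σ x y) hB) h

/-- Coefficients of one finite-dimensional irreducible representation at orthogonal vectors are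
orthogonal. -/
theorem integral_matrixCoeff_mul_star_of_inner_eq_zero
    {π : UnitaryRep G H}
    (hπ : π.IsIrreducible) (x u y v : H) (huv : inner ℂ v u = 0) :
    ∫ t, π.matrixCoeff u x t * star (π.matrixCoeff v y t) ∂μ = 0 := by
  have := FiniteDimensional.complete ℂ H
  rw [← inner_averagedRankOne]
  obtain ⟨c, hc⟩ := hπ.exists_eq_smul _ (averagedRankOne_toHom μ π π x y)
  rw [hc, inner_smul_right, huv, mul_zero]

end UnitaryRep

/-! ### Finite-dimensional subrepresentations -/

namespace UnitaryRep

section Irreducible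

variable {G : Type*} [Group G] [TopologicalSpace G]
variable {H : Type*} [NormedAddCommGroup H] [InnerProductSpace ℂ H]

/-- A nonzero finite-dimensional invariant subspace contains an irreducible one, namely one of
minimal dimension. -/
theorem exists_irreducible_le (π : UnitaryRep G H) (V : Submodule ℂ H) [FiniteDimensional ℂ V]
    (hV : ∀ g : G, ∀ x ∈ V, π.toHom g x ∈ V) (hV0 : V ≠ ⊥) :
    ∃ (W : Submodule ℂ H) (hW : ∀ g : G, ∀ x ∈ W, π.toHom g x ∈ W),
      W ≤ V ∧ (π.restrict W hW).IsIrreducible := by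
  let S : Set (Submodule ℂ H) :=
    {W | W ≤ V ∧ W ≠ ⊥ ∧ ∀ g : G, ∀ x ∈ W, π.toHom g x ∈ W}
  obtain ⟨W, ⟨hWV, hW0, hW⟩, hmin⟩ := exists_minimalFor_of_wellFoundedLT (· ∈ S)
    (fun W => Module.finrank ℂ W) ⟨V, le_rfl, hV0, hV⟩
  have hfd : FiniteDimensional ℂ W := Submodule.finiteDimensional_of_le hWV
  refine ⟨W, hW, hWV, (Submodule.nontrivial_iff_ne_bot).2 hW0, fun X _ hX => ?_⟩
  by_cases hX0 : X = ⊥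
  · exact Or.inl hX0
  refine Or.inr ?_
  have hXS : X.map W.subtype ∈ S := by
    refine ⟨(Submodule.map_subtype_le W X).trans hWV, fun h => hX0 ?_, ?_⟩
    · exact Submodule.map_injective_of_injective W.injective_subtype
        (h.trans (Submodule.map_bot _).symm)
    · rintro g _ ⟨x, hx, rfl⟩
      exact ⟨_, hX g x hx, rfl⟩
  have hfin : Module.finrank ℂ (X.map W.subtype) = Module.finrank ℂ X :=
    (X.equivMapOfInjective W.subtype W.injective_subtype).finrank_eq.symm
  have h1 : Module.finrank ℂ W ≤ Module.finrank ℂ X := by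
    rw [← hfin]
    exact hmin hXS (hfin.trans_le (Submodule.finrank_le X))
  exact Submodule.eq_top_of_finrank_eq (le_antisymm (Submodule.finrank_le X) h1)

end Irreducible

section Compact

variable {G : Type*} [Group G] [TopologicalSpace G] [CompactSpace G]
variable {H : Type*} [NormedAddCommGroup H] [InnerProductSpace ℂ H]

/-- The map sending `x` to the coefficient `g ↦ ⟪w, π(g) x⟫`. -/
noncomputable def coeffMap (π : UnitaryRep G H) (w : H) : H →L[ℂ] C(G, ℂ) :=
  LinearMap.mkContinuous
    { toFun := fun x => π.matrixCoeff x w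
      map_add' := fun x y => by ext g; simp [matrixCoeff_apply]
      map_smul' := fun c x => by ext g; simp [matrixCoeff_apply] } ‖w‖
    fun x => (ContinuousMap.norm_le _ (by positivity)).2 fun g => by
      simpa using! norm_inner_le_norm (𝕜 := ℂ) w (π.toHom g x)

variable [IsTopologicalGroup G]

/-- The coefficients `⟪w, π(·) x⟫ = ⟪π(·)⁻¹ w, x⟫` with `x` in a ball are equicontinuous because
the orbit map of `w` is continuous, so the Arzelà–Ascoli theorem applies. -/
theorem isCompactOperator_coeffMap (π : UnitaryRep G H) (w : H) :
    IsCompactOperator (π.coeffMap w) := by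
  let L := ContinuousMap.linearIsometryBoundedOfCompact G ℂ ℂ
  suffices h : IsCompactOperator (L.toContinuousLinearEquiv.toContinuousLinearMap ∘L
      π.coeffMap w) by
    have h2 := h.clm_comp L.symm.toContinuousLinearEquiv.toContinuousLinearMap
    convert! h2 using 1
  rw [isCompactOperator_iff_exists_mem_nhds_isCompact_closure_image]
  refine ⟨Metric.ball 0 1, Metric.ball_mem_nhds _ one_pos, ?_⟩
  refine BoundedContinuousFunction.arzela_ascoli (Metric.closedBall (0 : ℂ) ‖w‖)
    (isCompact_closedBall _ _) _ ?_ ?_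
  · rintro _ g ⟨x, hx, rfl⟩
    have hx1 : ‖x‖ ≤ 1 := by simpa using (mem_ball_zero_iff.1 hx).le
    refine mem_closedBall_zero_iff.2 ((norm_inner_le_norm (𝕜 := ℂ) w (π.toHom g x)).trans ?_)
    rw [LinearIsometryEquiv.norm_map]
    exact mul_le_of_le_one_right (norm_nonneg _) hx1
  · intro g₀
    rw [Metric.equicontinuousAt_iff_right]
    intro ε hε
    have hc : Continuous fun g : G => π.toHom g⁻¹ w := (π.continuous_apply w).comp continuous_inv
    have hnhds : ∀ᶠ g in nhds g₀, dist (π.toHom g⁻¹ w) (π.toHom g₀⁻¹ w) < ε :=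
      (Metric.tendsto_nhds.1 (hc.tendsto g₀)) ε hε
    filter_upwards [hnhds] with g hg
    rintro ⟨_, x, hx, rfl⟩
    have hx1 : ‖x‖ ≤ 1 := by simpa using (mem_ball_zero_iff.1 hx).le
    change dist (inner ℂ w (π.toHom g₀ x)) (inner ℂ w (π.toHom g x)) < ε
    rw [← inner_toHom_inv, ← inner_toHom_inv π g, dist_eq_norm, ← inner_sub_left]
    refine ((norm_inner_le_norm _ _).trans
      (mul_le_of_le_one_right (norm_nonneg _) hx1)).trans_lt ?_
    rwa [← dist_eq_norm, dist_comm]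

variable [MeasurableSpace G] [BorelSpace G] [CompleteSpace H]

/-- Every nonzero vector `w` of a unitary representation has a nonzero coefficient `⟪w, π(·) x⟫`
with `x` in a finite-dimensional irreducible subspace. Writing `A` for the coefficient map of `w`
into `L²`, the operator `A* A` is compact, self-adjoint, nonzero, and commutes with `π`, so
it has a finite-dimensional invariant eigenspace on which `A` is injective. -/
theorem exists_irreducible_matrixCoeff_ne_zero (μ : Measure G) [μ.IsHaarMeasure]
    (π : UnitaryRep G H) {w : H} (hw : w ≠ 0) :
    ∃ (W : Submodule ℂ H) (hW : ∀ g : G, ∀ x ∈ W, π.toHom g x ∈ W),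
      FiniteDimensional ℂ W ∧ (π.restrict W hW).IsIrreducible ∧
        ∃ x ∈ W, π.matrixCoeff x w ≠ 0 := by
  have hright := Measure.isMulRightInvariant_of_compactSpace μ
  let A : H →L[ℂ] Lp ℂ 2 μ := ContinuousMap.toLp 2 μ ℂ ∘L π.coeffMap w
  have hAapply : ∀ x, A x = ContinuousMap.toLp 2 μ ℂ (π.matrixCoeff x w) := fun _ => rfl
  have hAker : ∀ x, A x = 0 → π.matrixCoeff x w = 0 := fun x hx =>
    ContinuousMap.toLp_injective (p := 2) (𝕜 := ℂ) μ (by rw [← hAapply, hx, map_zero])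
  let T : H →L[ℂ] H := A.adjoint ∘L A
  have hTinner : ∀ x y, inner ℂ x (T y) = inner ℂ (A x) (A y) := fun x y =>
    ContinuousLinearMap.adjoint_inner_right A x (A y)
  have hTker : ∀ x, T x = 0 → π.matrixCoeff x w = 0 := fun x hx => by
    refine hAker x (inner_self_eq_zero (𝕜 := ℂ).1 ?_)
    rw [← hTinner, hx, inner_zero_right]
  have hTc : IsCompactOperator T := by
    have h1 : IsCompactOperator (ContinuousMap.toLp 2 μ ℂ ∘L π.coeffMap w) :=
      (π.isCompactOperator_coeffMap w).clm_comp (ContinuousMap.toLp 2 μ ℂ)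
    exact h1.clm_comp A.adjoint
  have hTs : T.IsSymmetric := fun x y => by
    rw [← inner_conj_symm]
    change star (inner ℂ y (T x)) = inner ℂ x (T y)
    rw [hTinner, hTinner, RCLike.star_def, inner_conj_symm]
  have hT0 : T ≠ 0 := fun h => by
    have h1 := DFunLike.congr_fun (hTker w (by rw [h]; rfl)) 1
    rw [matrixCoeff_apply, toHom_one_apply] at h1
    exact hw (inner_self_eq_zero (𝕜 := ℂ).1 h1)
  -- `A` intertwines `π` with right translation, which preserves the inner product of `L²`.
  have hAinner : ∀ g x y, inner ℂ (A (π.toHom g x)) (A (π.toHom g y)) = inner ℂ (A x) (A y) := by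
    intro g x y
    simp only [hAapply, ContinuousMap.inner_toLp]
    rw [← integral_mul_right_eq_self
      (fun t => π.matrixCoeff y w t * (starRingEnd ℂ) (π.matrixCoeff x w t)) g]
    simp only [matrixCoeff_apply, toHom_mul_apply]
  have hTcomm : ∀ g x, T (π.toHom g x) = π.toHom g (T x) := fun g x => by
    refine ext_inner_left ℂ fun y => ?_
    have h1 : y = π.toHom g (π.toHom g⁻¹ y) := by
      rw [← toHom_mul_apply, mul_inv_cancel, toHom_one_apply]
    rw [← inner_toHom_inv, hTinner, hTinner]
    conv_lhs => rw [h1]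
    exact hAinner g _ x
  obtain ⟨c, hc, hc0⟩ : ∃ c, Module.End.HasEigenvalue (T : Module.End ℂ H) c ∧ c ≠ 0 := by
    by_contra! h
    exact hT0 ((ContinuousLinearMap.eq_zero_of_forall_hasEigenvalue_eq_zero hTc hTs).1 h)
  have hfd := ContinuousLinearMap.finite_dimensional_eigenspace hTc c hc0
  obtain ⟨W, hW, hWle, hirr⟩ := π.exists_irreducible_le
    (Module.End.eigenspace (T : Module.End ℂ H) c) (fun g x hx => by
      rw [Module.End.mem_eigenspace_iff] at hx ⊢
      exact (hTcomm g x).trans (by rw [← map_smul]; exact congrArg _ hx)) hc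
  refine ⟨W, hW, Submodule.finiteDimensional_of_le hWle, hirr, ?_⟩
  have := hirr.1
  obtain ⟨x, hx0⟩ := exists_ne (0 : W)
  refine ⟨x, x.2, fun hx => hx0 ?_⟩
  have h1 : T x = c • (x : H) := Module.End.mem_eigenspace_iff.1 (hWle x.2)
  have h2 : T x = 0 := by
    change A.adjoint (A x) = 0
    rw [hAapply, hx, map_zero, map_zero]
  exact Subtype.ext ((smul_eq_zero.1 (h1.symm.trans h2)).resolve_left hc0)

end Compact
end UnitaryRep

/-! ### Convolution-type functions and their coefficients -/

section Convolution

variable {G : Type*} [Group G] [TopologicalSpace G] [IsTopologicalGroup G] [CompactSpace G]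
  [SecondCountableTopology G] [MeasurableSpace G] [BorelSpace G]
  (μ : Measure G) [μ.IsHaarMeasure]

theorem ContinuousMap.memLp_top {X : Type*} [TopologicalSpace X] [CompactSpace X]
    [SecondCountableTopology X] [MeasurableSpace X] [BorelSpace X] (μ : Measure X)
    [IsFiniteMeasure μ] (φ : C(X, ℂ)) : MemLp φ ∞ μ :=
  (memLp_congr_ae (ContinuousMap.coeFn_toLp μ φ)).1 (Lp.memLp (ContinuousMap.toLp ∞ μ ℂ φ))

/-- Fubini's theorem for `s ↦ ∫ h(t) f(s⁻¹ t) dt` against a continuous function, after the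
substitution `s = t r⁻¹`, which preserves Haar measure as `G` is unimodular. -/
theorem integral_continuousMap_mul_integral_translate {h f : G → ℂ} (hh : MemLp h ∞ μ)
    (hf : Integrable f μ) (φ : C(G, ℂ)) :
    ∫ s, φ s * ∫ t, h t * f (s⁻¹ * t) ∂μ ∂μ = ∫ t, h t * ∫ r, φ (t * r⁻¹) * f r ∂μ ∂μ := by
  have := Measure.isMulRightInvariant_of_compactSpace μ
  have := Measure.isInvInvariant_of_compactSpace μ
  have hint : Integrable (fun p : G × G => φ p.1 * (h p.2 * f (p.1⁻¹ * p.2))) (μ.prod μ) := by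
    have h1 : Integrable (fun p : G × G => f (p.1⁻¹ * p.2)) (μ.prod μ) :=
      (measurePreserving_prod_inv_mul μ μ).integrable_comp_of_integrable (hf.comp_snd μ)
    have h2 : MemLp (fun p : G × G => h p.2) ∞ (μ.prod μ) :=
      hh.comp_snd μ
    have h3 : MemLp (fun p : G × G => φ p.1) ∞ (μ.prod μ) :=
      (φ.memLp_top μ).comp_fst μ
    exact (h1.mul_of_top_right h2).mul_of_top_right h3
  calc ∫ s, φ s * ∫ t, h t * f (s⁻¹ * t) ∂μ ∂μ
      = ∫ s, ∫ t, φ s * (h t * f (s⁻¹ * t)) ∂μ ∂μ := by simp only [integral_const_mul]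
    _ = ∫ t, ∫ s, φ s * (h t * f (s⁻¹ * t)) ∂μ ∂μ := integral_integral_swap hint
    _ = ∫ t, h t * ∫ s, φ s * f (s⁻¹ * t) ∂μ ∂μ := by
        simp only [← integral_const_mul, mul_left_comm]
    _ = ∫ t, h t * ∫ r, φ (t * r⁻¹) * f r ∂μ ∂μ := by
        refine integral_congr_ae (Filter.Eventually.of_forall fun t => ?_)
        dsimp only
        rw [← integral_div_left_eq_self (fun s => φ s * f (s⁻¹ * t)) μ t]
        simp only [div_eq_mul_inv, mul_inv_rev, inv_inv, inv_mul_cancel_right]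

namespace UnitaryRep

/-- The coefficients of `s ↦ ∫ h(t) f(s⁻¹ t) dt` factor into coefficients of `h` and of `f`. -/
theorem integral_matrixCoeff_mul_integral_translate {K : Type*} [NormedAddCommGroup K]
    [InnerProductSpace ℂ K] {n : Type*} [Fintype n] (σ : UnitaryRep G K)
    (b : OrthonormalBasis n ℂ K) (x y : K) {h f : G → ℂ} (hh : MemLp h ∞ μ)
    (hf : Integrable f μ) :
    ∫ s, σ.matrixCoeff x y s * ∫ t, h t * f (s⁻¹ * t) ∂μ ∂μ =
      ∑ m, (∫ t, h t * σ.matrixCoeff (b m) y t ∂μ) *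
        ∫ r, star (σ.matrixCoeff (b m) x r) * f r ∂μ := by
  have hfi : ∀ φ : C(G, ℂ), Integrable (fun r => star (φ r) * f r) μ := fun φ =>
    hf.mul_of_top_right ((star φ).memLp_top μ)
  have hhi : ∀ φ : C(G, ℂ), Integrable (fun t => h t * φ t) μ := fun φ =>
    ((φ.memLp_top μ).integrable le_top).mul_of_top_right hh
  rw [integral_continuousMap_mul_integral_translate μ hh hf]
  simp only [σ.matrixCoeff_mul_inv b, Finset.sum_mul, mul_assoc]
  calc ∫ t, h t * ∫ r, ∑ m, σ.matrixCoeff (b m) y t *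
          (star (σ.matrixCoeff (b m) x r) * f r) ∂μ ∂μ
      = ∫ t, ∑ m, (h t * σ.matrixCoeff (b m) y t) *
          ∫ r, star (σ.matrixCoeff (b m) x r) * f r ∂μ ∂μ := by
        refine integral_congr_ae (Filter.Eventually.of_forall fun t => ?_)
        dsimp only
        rw [integral_finsetSum _ fun m _ => (hfi _).const_mul _]
        simp only [integral_const_mul, Finset.mul_sum, mul_assoc]
    _ = _ := by
        rw [integral_finsetSum _ fun m _ => (hhi _).mul_const _]
        simp only [integral_mul_const]

end UnitaryRep

end Convolution

/-! ### Completeness of the matrix coefficients -/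

namespace UnitaryRep

universe u v w

/-- A finite-dimensional irreducible representation on a space in any universe is equivalent to a
member of the unitary dual: its model on `ℂⁿ` lives in every universe. -/
theorem IsUnitaryDual.exists_equivalent {G : Type u} [Group G] [TopologicalSpace G] {ι : Type w}
    {H : ι → Type v} [∀ i, NormedAddCommGroup (H i)] [∀ i, InnerProductSpace ℂ (H i)]
    {π : ∀ i, UnitaryRep G (H i)} (hπ : IsUnitaryDual π) {K : Type*} [NormedAddCommGroup K]
    [InnerProductSpace ℂ K] [FiniteDimensional ℂ K] {σ : UnitaryRep G K}
    (hσ : σ.IsIrreducible) : ∃ i, σ.Equivalent (π i) := by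
  let b : OrthonormalBasis (ULift.{v} (Fin (Module.finrank ℂ K))) ℂ K :=
    (stdOrthonormalBasis ℂ K).reindex Equiv.ulift.symm
  obtain ⟨i, hi⟩ := hπ.exhaustive _ _ (hσ.transport b.repr)
  exact ⟨i, (σ.equivalent_transport b.repr).trans hi⟩

variable {G : Type u} [Group G] [TopologicalSpace G] [IsTopologicalGroup G] [CompactSpace G]
  [SecondCountableTopology G] [MeasurableSpace G] [BorelSpace G]
  (μ : Measure G) [μ.IsHaarMeasure]

/-- The left regular representation `(L_s f)(t) = f(s⁻¹ t)` on `L²(G)`. -/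
noncomputable def leftRegular : UnitaryRep G (Lp ℂ 2 μ) where
  toHom :=
    { toFun := fun s =>
        { toFun := fun f => DomMulAct.mk s⁻¹ • f
          invFun := fun f => DomMulAct.mk s • f
          map_add' := fun f g => smul_add _ f g
          map_smul' := fun c f => smul_comm _ c f
          left_inv := fun f => by
            change DomMulAct.mk s • DomMulAct.mk s⁻¹ • f = f
            rw [smul_smul, ← DomMulAct.mk_mul]
            simp
          right_inv := fun f => by
            change DomMulAct.mk s⁻¹ • DomMulAct.mk s • f = f
            rw [smul_smul, ← DomMulAct.mk_mul]
            simp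
          norm_map' := fun f => DomMulAct.norm_smul_Lp _ f }
      map_one' := by
        ext1 f
        change DomMulAct.mk (1 : G)⁻¹ • f = f
        rw [inv_one, DomMulAct.mk_one, one_smul]
      map_mul' := fun s t => by
        ext1 f
        change DomMulAct.mk (s * t)⁻¹ • f = DomMulAct.mk s⁻¹ • DomMulAct.mk t⁻¹ • f
        rw [smul_smul, ← DomMulAct.mk_mul, mul_inv_rev] }
  continuous_apply f :=
    have : Fact ((2 : ℝ≥0∞) ≠ ∞) := ⟨ENNReal.ofNat_ne_top⟩
    (DomMulAct.continuous_mk.comp continuous_inv).smul continuous_const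

theorem leftRegular_apply (s : G) (f : Lp ℂ 2 μ) :
    (leftRegular μ).toHom s f = DomMulAct.mk s⁻¹ • f := rfl

theorem matrixCoeff_leftRegular (F : C(G, ℂ)) (f : Lp ℂ 2 μ) (s : G) :
    (leftRegular μ).matrixCoeff f (ContinuousMap.toLp 2 μ ℂ F) s =
      star (∫ t, F t * star (f (s⁻¹ * t)) ∂μ) := by
  rw [matrixCoeff_apply, leftRegular_apply, L2.inner_def, RCLike.star_def, ← integral_conj]
  refine integral_congr_ae ?_
  filter_upwards [ContinuousMap.coeFn_toLp (p := 2) (𝕜 := ℂ) μ F,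
    DomMulAct.smul_Lp_ae_eq (DomMulAct.mk s⁻¹) f] with t h1 h2
  rw [h1, h2]
  simp [mul_comm]

/-- **Peter–Weyl**: a continuous function annihilated by all matrix coefficients of the unitary
dual vanishes. If `F ≠ 0`, the left regular representation has a finite-dimensional
irreducible subspace containing some `f` with `c(s) = ⟪F, L_s f⟫` not identically zero. As `c`
is a coefficient of that subrepresentation and `conj c(s) = ∫ F(t) conj f(s⁻¹ t) dt`, the product
formula for coefficients expresses `∫ |c|²` through integrals of `F` against coefficients, which
vanish. -/
theorem IsUnitaryDual.eq_zero_of_integral_mul_matrixCoeff {ι : Type w}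
    {H : ι → Type v} [∀ i, NormedAddCommGroup (H i)] [∀ i, InnerProductSpace ℂ (H i)]
    {π : ∀ i, UnitaryRep G (H i)} (hπ : IsUnitaryDual π) {n : ι → Type*} [∀ i, Fintype (n i)]
    (e : ∀ i, OrthonormalBasis (n i) ℂ (H i)) (F : C(G, ℂ))
    (hF : ∀ i k l, ∫ t, F t * (π i).matrixCoeff (e i l) (e i k) t ∂μ = 0) : F = 0 := by
  by_contra hF0
  have hw : ContinuousMap.toLp 2 μ ℂ F ≠ 0 := fun h =>
    hF0 (ContinuousMap.toLp_injective (p := 2) (𝕜 := ℂ) μ (by rw [h, map_zero]))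
  obtain ⟨W, hW, hfd, hirr, f, hfW, hc⟩ :=
    exists_irreducible_matrixCoeff_ne_zero μ (leftRegular μ) hw
  set ρ := (leftRegular μ).restrict W hW
  obtain ⟨i, U, hU⟩ := hπ.exists_equivalent hirr
  have hint : ∀ φ : C(G, ℂ), Integrable (fun t => F t * φ t) μ := fun φ =>
    (F * φ).continuous.integrable_of_hasCompactSupport (HasCompactSupport.of_compactSpace _)
  have hρ : ∀ x y : W, ∫ t, F t * ρ.matrixCoeff x y t ∂μ = 0 := fun x y => by
    rw [Equivalent.matrixCoeff_eq hU, matrixCoeff_eq_sum _ (e i)]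
    simp only [ContinuousMap.sum_apply, ContinuousMap.smul_apply, smul_eq_mul, Finset.mul_sum,
      mul_left_comm (F _)]
    rw [integral_finsetSum _ fun l _ => integrable_finsetSum _ fun k _ => (hint _).const_mul _]
    refine Finset.sum_eq_zero fun l _ => ?_
    rw [integral_finsetSum _ fun k _ => (hint _).const_mul _]
    refine Finset.sum_eq_zero fun k _ => ?_
    rw [integral_const_mul, hF, mul_zero]
  set c := (leftRegular μ).matrixCoeff f (ContinuousMap.toLp 2 μ ℂ F) with hcdef
  have hcρ : c =
      ρ.matrixCoeff ⟨f, hfW⟩ (W.orthogonalProjectionOnto (ContinuousMap.toLp 2 μ ℂ F)) := by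
    ext s
    exact (Submodule.inner_orthogonalProjectionOnto_eq_of_mem_right
      (ρ.toHom s ⟨f, hfW⟩) (ContinuousMap.toLp 2 μ ℂ F)).symm
  have hfi : Integrable (fun t => star (f t)) μ :=
    (Lp.memLp f).star.integrable one_le_two
  have h0 : ∫ s, c s * star (c s) ∂μ = 0 := by
    have := ρ.integral_matrixCoeff_mul_integral_translate μ (stdOrthonormalBasis ℂ W) ⟨f, hfW⟩
      (W.orthogonalProjectionOnto (ContinuousMap.toLp 2 μ ℂ F)) (F.memLp_top μ) hfi
    rw [← hcρ] at this
    simp only [hρ, zero_mul, Finset.sum_const_zero] at this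
    rw [← this]
    refine integral_congr_ae (Filter.Eventually.of_forall fun s => ?_)
    dsimp only
    rw [hcdef, matrixCoeff_leftRegular, star_star]
  have h1 : inner ℂ (ContinuousMap.toLp 2 μ ℂ c) (ContinuousMap.toLp 2 μ ℂ c) = (0 : ℂ) := by
    rw [ContinuousMap.inner_toLp]; exact h0
  exact hc (ContinuousMap.toLp_injective (p := 2) (𝕜 := ℂ) μ
    (by rw [inner_self_eq_zero.1 h1, map_zero]))

end UnitaryRep

/-! ### The weak* closure of a subspace -/

/-- The nontrivial half of the bipolar theorem: a point outside the weak closure of a subspace is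
separated from it by an element of the paired space. -/
theorem WeakBilin.exists_eq_zero_ne_zero_of_notMem_closure {X Y : Type*} [AddCommGroup X]
    [Module ℂ X] [AddCommGroup Y] [Module ℂ Y] (B : X →ₗ[ℂ] Y →ₗ[ℂ] ℂ) (V : Submodule ℂ X) {x : X}
    (hx : x ∉ @closure X (WeakBilin.instTopologicalSpace B) (V : Set X)) :
    ∃ y, (∀ v ∈ V, B v y = 0) ∧ B x y ≠ 0 := by
  let V' : Submodule ℂ (WeakBilin B) := V
  have := IsScalarTower.continuousSMul (M := ℝ) (α := WeakBilin B) ℂ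
  have hconv : Convex ℝ (closure (V' : Set (WeakBilin B))) :=
    (V'.restrictScalars ℝ).convex.closure
  obtain ⟨φ, u, hφ, hu⟩ := RCLike.geometric_hahn_banach_closed_point (𝕜 := ℂ) hconv
    isClosed_closure hx
  obtain ⟨y, hy⟩ := LinearMap.dualEmbedding_surjective B φ
  have hφy : ∀ z : X, φ z = B z y := fun z => by rw [← hy]; rfl
  have hu0 : 0 < u := by
    have := hφ 0 (subset_closure V'.zero_mem)
    simpa using this
  have hVy : ∀ v ∈ V, B v y = 0 := fun v hv => by
    by_contra hne
    -- A multiple of `v` on which the functional takes the forbidden value `u`.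
    have h1 := hφ (((u : ℂ) / B v y) • v : X) (subset_closure (V'.smul_mem _ hv))
    rw [hφy, map_smul, LinearMap.smul_apply, smul_eq_mul, div_mul_cancel₀ _ hne] at h1
    simp at h1
  refine ⟨y, hVy, fun h => ?_⟩
  have hu' : u < RCLike.re (φ x) := hu
  rw [hφy, h, map_zero] at hu'
  exact hu'.not_gt hu0

section Annihilator

variable {G : Type*} [MeasurableSpace G] (μ : Measure G)

theorem mem_linftyAnnihilator {J : Submodule ℂ (Lp ℂ 1 μ)} {h : Lp ℂ ∞ μ} :
    h ∈ linftyAnnihilator μ J ↔ ∀ f ∈ J, linftyPairing μ h f = 0 := Iff.rfl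

theorem continuous_linftyPairing (h : Lp ℂ ∞ μ) : Continuous (linftyPairing μ h) :=
  ((ContinuousLinearMap.mul ℂ ℂ).lpPairing μ ∞ 1 h).continuous

/-- Annihilators are weak*-closed. -/
theorem isClosed_linftyAnnihilator (J : Submodule ℂ (Lp ℂ 1 μ)) :
    @IsClosed (Lp ℂ ∞ μ) (weakStarTopology μ) (linftyAnnihilator μ J : Set (Lp ℂ ∞ μ)) := by
  let _ : TopologicalSpace (Lp ℂ ∞ μ) := weakStarTopology μ
  have h1 : (linftyAnnihilator μ J : Set (Lp ℂ ∞ μ)) =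
      ⋂ f ∈ J, {h | linftyPairing μ h f = 0} := by
    ext h
    simp [mem_linftyAnnihilator]
  rw [h1]
  exact isClosed_biInter fun f _ =>
    isClosed_eq (WeakBilin.eval_continuous (linftyPairing μ) f) continuous_const

/-- A functional vanishing on a set vanishes on its closed linear span. -/
theorem mem_linftyAnnihilator_span_closure (S : Set (Lp ℂ 1 μ)) {h : Lp ℂ ∞ μ} :
    h ∈ linftyAnnihilator μ (Submodule.span ℂ S).topologicalClosure ↔
      ∀ f ∈ S, linftyPairing μ h f = 0 := by
  rw [mem_linftyAnnihilator]
  refine ⟨fun H f hf => H f (Submodule.le_topologicalClosure _ (Submodule.subset_span hf)),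
    fun H f hf => ?_⟩
  have hle : Submodule.span ℂ S ≤ LinearMap.ker (linftyPairing μ h) :=
    Submodule.span_le.2 fun f hf => H f hf
  exact Submodule.topologicalClosure_minimal _ hle
    (isClosed_singleton.preimage (continuous_linftyPairing μ h)) hf

theorem linftyPairing_continuousMap_right [TopologicalSpace G] [CompactSpace G] [BorelSpace G]
    [SecondCountableTopology G] [IsFiniteMeasure μ] (h : Lp ℂ ∞ μ) (φ : C(G, ℂ)) :
    linftyPairing μ h (ContinuousMap.toLp 1 μ ℂ φ) = ∫ t, h t * φ t ∂μ := by
  rw [linftyPairing_apply]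
  refine integral_congr_ae ?_
  filter_upwards [ContinuousMap.coeFn_toLp (p := 1) (𝕜 := ℂ) μ φ] with t ht
  rw [ht]

theorem linftyPairing_continuousMap_left [TopologicalSpace G] [CompactSpace G] [BorelSpace G]
    [SecondCountableTopology G] [IsFiniteMeasure μ] (φ : C(G, ℂ)) (f : Lp ℂ 1 μ) :
    linftyPairing μ (ContinuousMap.toLp ∞ μ ℂ φ) f = ∫ t, φ t * f t ∂μ := by
  rw [linftyPairing_apply]
  refine integral_congr_ae ?_
  filter_upwards [ContinuousMap.coeFn_toLp (p := ∞) (𝕜 := ℂ) μ φ] with t ht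
  rw [ht]

end Annihilator

/-! ### The annihilator of the ideal -/

section Main

variable {G : Type*} [Group G] [TopologicalSpace G] [IsTopologicalGroup G] [CompactSpace G]
  [SecondCountableTopology G] [MeasurableSpace G] [BorelSpace G]
  (μ : Measure G) [μ.IsHaarMeasure]

/-- The function `s ↦ ⟨h, L_s f⟩ = ∫ h(t) f(s⁻¹ t) dt`, continuous because translation is strongly
continuous on `L¹`. -/
noncomputable def translatePairing (h : Lp ℂ ∞ μ) (f : Lp ℂ 1 μ) : C(G, ℂ) where
  toFun s := linftyPairing μ h (DomMulAct.mk s⁻¹ • f)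
  continuous_toFun :=
    have : Fact ((1 : ℝ≥0∞) ≠ ∞) := ⟨ENNReal.one_ne_top⟩
    (continuous_linftyPairing μ h).comp
      ((DomMulAct.continuous_mk.comp continuous_inv).smul continuous_const)

theorem translatePairing_apply (h : Lp ℂ ∞ μ) (f : Lp ℂ 1 μ) (s : G) :
    translatePairing μ h f s = ∫ t, h t * f (s⁻¹ * t) ∂μ := by
  change linftyPairing μ h (DomMulAct.mk s⁻¹ • f) = _
  rw [linftyPairing_apply]
  refine integral_congr_ae ?_
  filter_upwards [DomMulAct.smul_Lp_ae_eq (DomMulAct.mk s⁻¹) f] with t ht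
  rw [ht]
  rfl

variable {ι : Type*} {H : ι → Type*} [∀ i, NormedAddCommGroup (H i)]
  [∀ i, InnerProductSpace ℂ (H i)] {π : ∀ i, UnitaryRep G (H i)}
  (E : ∀ i, Submodule ℂ (H i)) {d : ι → ℕ}
  (e : ∀ i, OrthonormalBasis (Fin (d i)) ℂ (H i))


/-- By Schur orthogonality the conjugates of the remaining coefficients annihilate `J(E)`. -/
theorem conjRemainingCoeffs_subset_linftyAnnihilator (hπ : UnitaryRep.IsUnitaryDual π) :
    conjRemainingCoeffs μ π E e ⊆ linftyAnnihilator μ (idealOf μ π E e) := by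
  have hfd : ∀ i, FiniteDimensional ℂ (H i) := fun i => (e i).toBasis.finiteDimensional_of_finite
  have key : ∀ (i j : ι) (k l : Fin (d i)) (k' l' : Fin (d j)),
      (∀ hij : i = j, (hij ▸ l : Fin (d j)) ≠ l') →
      linftyPairing μ (ContinuousMap.toLp ∞ μ ℂ (star ((π i).matrixCoeff (e i l) (e i k))))
        (ContinuousMap.toLp 1 μ ℂ ((π j).matrixCoeff (e j l') (e j k'))) = 0 := by
    intro i j k l k' l' hne
    rw [linftyPairing_continuousMap_left]
    have h1 : ∫ t, (π j).matrixCoeff (e j l') (e j k') t *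
        star ((π i).matrixCoeff (e i l) (e i k) t) ∂μ = 0 := by
      by_cases hij : i = j
      · subst hij
        exact UnitaryRep.integral_matrixCoeff_mul_star_of_inner_eq_zero μ (hπ.irreducible i)
          _ _ _ _ ((e i).inner_eq_zero (hne rfl))
      · exact UnitaryRep.integral_matrixCoeff_mul_star_of_not_equivalent μ (hπ.irreducible j)
          (hπ.irreducible i) (fun h => hij (hπ.eq_of_equivalent _ _ h).symm) _ _ _ _
    rw [← h1]
    refine integral_congr_ae ?_
    filter_upwards [ContinuousMap.coeFn_toLp (p := 1) (𝕜 := ℂ) μ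
      ((π j).matrixCoeff (e j l') (e j k'))] with t ht
    rw [ht, mul_comm]
    rfl
  rintro h (⟨i, k, l, -, hl, rfl⟩ | ⟨i, k, l, hE, rfl⟩)
  all_goals
    refine (mem_linftyAnnihilator_span_closure μ _).2 ?_
    rintro _ ⟨j, k', l', hE', hl', rfl⟩
    refine key i j k l k' l' fun hij => ?_
    subst hij
  · -- The column indices `l` and `l'` lie on different sides of `dim E_π`.
    rintro rfl
    exact absurd hl' hl.not_gt
  · exact absurd hE hE'

/-- If `h` annihilates `J(E)` and `f` is annihilated by the conjugates of the remaining
coefficients, then every coefficient of `s ↦ ⟨h, L_s f⟩` is a sum of products with a vanishing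
factor, so that this function vanishes identically and in particular at `s = 1`. -/
theorem linftyPairing_eq_zero_of_annihilates (hπ : UnitaryRep.IsUnitaryDual π) {h : Lp ℂ ∞ μ}
    (hh : h ∈ linftyAnnihilator μ (idealOf μ π E e)) {f : Lp ℂ 1 μ}
    (hf : ∀ v ∈ conjRemainingCoeffs μ π E e, linftyPairing μ v f = 0) :
    linftyPairing μ h f = 0 := by
  have hh' := (mem_linftyAnnihilator_span_closure μ _).1 hh
  have hF : translatePairing μ h f = 0 := by
    refine hπ.eq_zero_of_integral_mul_matrixCoeff μ e _ fun i k l => ?_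
    simp only [translatePairing_apply]
    have h1 := (π i).integral_matrixCoeff_mul_integral_translate μ (e i) (e i l) (e i k)
      (Lp.memLp h) ((Lp.memLp f).integrable le_rfl)
    simp only [mul_comm ((π i).matrixCoeff (e i l) (e i k) _)] at h1
    rw [h1]
    refine Finset.sum_eq_zero fun m _ => ?_
    by_cases hm : E i ≠ ⊥ ∧ (m : ℕ) < Module.finrank ℂ (E i)
    · have := hh' _ ⟨i, k, m, hm.1, hm.2, rfl⟩
      rw [linftyPairing_continuousMap_right] at this
      rw [this, zero_mul]
    · have hmem : ContinuousMap.toLp ∞ μ ℂ (star ((π i).matrixCoeff (e i m) (e i l))) ∈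
          conjRemainingCoeffs μ π E e := by
        by_cases hE : E i = ⊥
        · exact Or.inr ⟨i, l, m, hE, rfl⟩
        · exact Or.inl ⟨i, l, m, hE, not_lt.1 fun h => hm ⟨hE, h⟩, rfl⟩
      have := hf _ hmem
      rw [linftyPairing_continuousMap_left] at this
      exact mul_eq_zero_of_right _ this
  have h2 := translatePairing_apply μ h f 1
  rw [hF] at h2
  simpa [linftyPairing_apply] using h2.symm

end Main

theorem mainTheorem11 {G : Type*} [Group G] [TopologicalSpace G] [IsTopologicalGroup G]
    [CompactSpace G] [T2Space G] [SecondCountableTopology G] [MeasurableSpace G] [BorelSpace G]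
    (μ : Measure G) [μ.IsHaarMeasure]
    {ι : Type*} {H : ι → Type*} [∀ i, NormedAddCommGroup (H i)]
    [∀ i, InnerProductSpace ℂ (H i)]
    (π : ∀ i, UnitaryRep G (H i)) (hπ : UnitaryRep.IsUnitaryDual π)
    (E : ∀ i, Submodule ℂ (H i)) (d : ι → ℕ)
    (e : ∀ i, OrthonormalBasis (Fin (d i)) ℂ (H i))
    (he : ∀ i, Submodule.span ℂ (e i '' {l | (l : ℕ) < Module.finrank ℂ (E i)}) = E i) :
    (linftyAnnihilator μ (idealOf μ π E e) : Set (Lp ℂ ∞ μ)) =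
      @closure (Lp ℂ ∞ μ) (weakStarTopology μ)
        (Submodule.span ℂ (conjRemainingCoeffs μ π E e) : Set (Lp ℂ ∞ μ)) := by
  refine Set.Subset.antisymm (fun h hh => ?_) ?_
  · by_contra hcl
    obtain ⟨f, hf, hne⟩ := WeakBilin.exists_eq_zero_ne_zero_of_notMem_closure _ _ hcl
    exact hne (linftyPairing_eq_zero_of_annihilates μ E e hπ hh
      fun v hv => hf v (Submodule.subset_span hv))
  · refine @closure_minimal _ (weakStarTopology μ) _ _ ?_ (isClosed_linftyAnnihilator μ _)
    exact Submodule.span_le.2 (conjRemainingCoeffs_subset_linftyAnnihilator μ E e hπ)
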